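/- Fix a degree bound $\Delta\in\mathbb N$. Let $\mathbf{Gr}$ be the set of isomorphism classes $[G,o]$ of countable connected rooted simple graphs with all degrees at most $\Delta$, and $\vec{\mathbf{Gr}}$ the set of isomorphism classes $[G,o_1,o_2]$ of countable connected birooted graphs ($o_2$ a neighbour of $o_1$) with all degrees at most $\Delta$. Let $B_G(o,r)$ be the subgraph of $G$ induced by the vertices at distance at most $r$ from $o$. Equip $\mathbf{Gr}$ with the metric $\rho([G,o],[H,p])=2^{-r}$ for distinct classes, where $r$ is the supremum of the $s\in\mathbb N$ with $[B_G(o,s),o]=[B_H(p,s),p]$; equip $\vec{\mathbf{Gr}}$ with the analogous metric, defined by means of the balls $[B_G(o_1,s),o_1,o_2]$; and equip both with their Borel $\sigma$-algebras. For a measure $\nu$ on $\mathbf{Gr}$, let $\vec\nu$ be the measure on $\vec{\mathbf{Gr}}$ given by $\vec\nu(A)=\int |\{x\in N_G(o): [G,o,x]\in A\}|\,d\nu[G,o]$ for Borel $A$; $\nu$ is called involution invariant if $\iota_*\vec\nu=\vec\nu$, where $\iota[G,x,y]=[G,y,x]$. Let $\mathcal G=(X,i_1,\dots,i_k,\mu)$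 be a measurable graphing: $X$ is a standard Borel space, $\mu$ is a Borel probability measure on $X$, and each $i_j$ is a $\mu$-preserving Borel involution of $X$ (fixed points are allowed). Its leafgraph $\mathcal L$ is the simple graph on $X$ in which distinct $x,y$ are adjacent if and only if $y=i_j(x)$ for some $j$. Assume that all degrees of $\mathcal L$ are at most $\Delta$. The law $\Psi(\mathcal G)$ is the probability measure on $\mathbf{Gr}$ determined by \[\Psi(\mathcal G)\bigl(\{[G,o]\in\mathbf{Gr}: [B_G(o,r),o]=\alpha\}\bigr)=\mu\bigl(\{x\in X: [B_{\mathcal L}(x,r),x]=\alpha\}\bigr)\] for all $r\in\mathbb N$ and all $\alpha=[H,p]\in\mathbf{Gr}$ all of whose vertices are at distance at most $r$ from $p$. Let $S_{\mathcal L}=\{(x,y)\in X\times X: x \text{ and } y \text{ are adjacent in } \mathcal L\}$ and let $\vec\mu$ be the measure on $S_{\mathcal L}$ given by $\vec\mu(B)=\int_X|\{y\in N_{\mathcal L}(x):(x,y)\in B\}|\,d\mu(x)$ for Borel $B\subseteq S_{\mathcal L}$; $\mu$ is called involution invariant if $\vec\mu$ is invariant under $(x,y)\mapsto(y,x)$.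 Theorem. There is exactly one probability measure $\Psi(\mathcal G)$ on $\mathbf{Gr}$ with the property that defines the law, and $\Psi(\mathcal G)$ is involution invariant if and only if $\mu$ is involution invariant. -/

import Mathlib

open MeasureTheory
open scoped ENNReal

universe u

namespace Graphings

/-! ### Balls in graphs -/

/-- The vertex set of `B_G(o, r)`: the vertices of the component of `o` at distance at most `r` from
`o` (`edist` is `⊤` between different components). -/
def closedBall {V : Type u} (G : SimpleGraph V) (o : V) (r : ℕ) : Set V :=
  {x | G.edist o x ≤ r}

theorem root_mem_closedBall {V : Type u} (G : SimpleGraph V) (o : V) (r : ℕ) :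
    o ∈ closedBall G o r := by
  simp [closedBall]

theorem edist_map_le {V W : Type u} {G : SimpleGraph V} {H : SimpleGraph W} (φ : G →g H)
    (a b : V) : H.edist (φ a) (φ b) ≤ G.edist a b := by
  by_cases h : G.edist a b = ⊤
  · simp [h]
  · obtain ⟨p, hp⟩ := SimpleGraph.exists_walk_of_edist_ne_top h
    rw [← hp, ← SimpleGraph.Walk.length_map φ p]
    exact SimpleGraph.edist_le _

theorem edist_iso {V W : Type u} {G : SimpleGraph V} {H : SimpleGraph W} (φ : G ≃g H)
    (a b : V) : H.edist (φ a) (φ b) = G.edist a b := by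
  apply le_antisymm (edist_map_le φ.toHom a b)
  simpa using edist_map_le φ.symm.toHom (φ a) (φ b)

theorem closedBall_connected {V : Type u} (G : SimpleGraph V) (o : V) (r : ℕ) :
    (G.induce (closedBall G o r)).Connected := by
  rw [SimpleGraph.connected_iff_exists_forall_reachable]
  refine ⟨⟨o, root_mem_closedBall G o r⟩, ?_⟩
  rintro ⟨y, hy⟩
  have hy' : G.edist o y ≤ r := hy
  have hne : G.edist o y ≠ ⊤ := ne_top_of_le_ne_top (ENat.natCast_ne_top r) hy'
  obtain ⟨p, hp⟩ := SimpleGraph.exists_walk_of_edist_ne_top hne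
  have hs : ∀ x ∈ p.support, x ∈ closedBall G o r := by
    classical
    intro x hx
    calc G.edist o x ≤ (p.takeUntil x hx).length := SimpleGraph.edist_le _
      _ ≤ p.length := by exact_mod_cast p.length_takeUntil_le_length hx
      _ ≤ r := hp ▸ hy'
  exact ⟨p.induce _ hs⟩

theorem closedBall_finite {V : Type u} (G : SimpleGraph V) {Δ : ℕ}
    (hG : ∀ x, (G.neighborSet x).encard ≤ Δ) (o : V) (r : ℕ) : (closedBall G o r).Finite := by
  induction r with
  | zero =>
    refine (Set.finite_singleton o).subset ?_
    intro x hx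
    simpa [closedBall] using hx
  | succ r ih =>
    have hf : ((closedBall G o r) ∪ ⋃ x ∈ closedBall G o r, G.neighborSet x).Finite := by
      refine ih.union (ih.biUnion fun x _ => ?_)
      exact Set.finite_of_encard_le_coe (hG x)
    refine hf.subset ?_
    intro y hy
    have hy' : G.edist o y ≤ ((r + 1 : ℕ) : ℕ∞) := hy
    have hne : G.edist o y ≠ ⊤ := ne_top_of_le_ne_top (ENat.natCast_ne_top _) hy'
    obtain ⟨p, hp⟩ := SimpleGraph.exists_walk_of_edist_ne_top hne
    rw [← hp] at hy'
    have hl : p.length ≤ r + 1 := by exact_mod_cast hy'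
    by_cases h0 : p.Nil
    · left
      have := h0.eq
      subst this
      exact root_mem_closedBall G o r
    · right
      have hadj := p.adj_penultimate h0
      refine Set.mem_biUnion (x := p.penultimate) ?_ hadj
      have h1 : G.edist o p.penultimate ≤ p.dropLast.length := SimpleGraph.edist_le _
      refine h1.trans ?_
      have : p.dropLast.length = p.length - 1 := by simp
      rw [this]
      exact_mod_cast (by omega : p.length - 1 ≤ r)

/-! ### Rooted graphs and the space `𝐆𝐫` -/

/-- A countable connected rooted graph with all degrees at most `Δ`. -/
structure RootedGraph (Δ : ℕ) : Type (u + 1) where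
  /-- the vertices -/
  V : Type u
  /-- the edges -/
  graph : SimpleGraph V
  countable : Countable V
  connected : graph.Connected
  degree_le : ∀ x, (graph.neighborSet x).encard ≤ Δ
  /-- the root -/
  root : V

/-- Isomorphism of rooted graphs. -/
instance RootedGraph.setoid (Δ : ℕ) : Setoid (RootedGraph.{u} Δ) where
  r R S := ∃ φ : R.graph ≃g S.graph, φ R.root = S.root
  iseqv :=
    { refl := fun R => ⟨SimpleGraph.Iso.refl, rfl⟩
      symm := by
        rintro R S ⟨φ, h⟩
        exact ⟨φ.symm, by simp [← h]⟩
      trans := by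
        rintro R S T ⟨φ, h⟩ ⟨ψ, h'⟩
        exact ⟨φ.trans ψ, by simp [h, h']⟩ }

/-- `𝐆𝐫`: the isomorphism classes `[G, o]` of countable connected rooted graphs with degrees at most
`Δ`. -/
def Gr (Δ : ℕ) : Type (u + 1) := Quotient (RootedGraph.setoid.{u} Δ)

/-- The isomorphism class `[G, o]`. -/
def RootedGraph.cls {Δ : ℕ} (R : RootedGraph.{u} Δ) : Gr.{u} Δ := Quotient.mk _ R

/-- The rooted graph `(B_G(o, r), o)`, for any graph `G` with degrees at most `Δ`. -/
def rootedBall {V : Type u} {Δ : ℕ} (G : SimpleGraph V)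
    (hG : ∀ x, (G.neighborSet x).encard ≤ Δ) (o : V) (r : ℕ) : RootedGraph.{u} Δ where
  V := closedBall G o r
  graph := G.induce (closedBall G o r)
  countable := (closedBall_finite G hG o r).countable.to_subtype
  connected := closedBall_connected G o r
  degree_le := by
    intro x
    refine le_trans ?_ (hG x)
    rw [← Subtype.val_injective.encard_image]
    apply Set.encard_le_encard
    rintro _ ⟨y, hy, rfl⟩
    exact hy
  root := ⟨o, root_mem_closedBall G o r⟩

/-- The isomorphism class `[B_G(o, r), o]`, for any graph `G` with degrees at most `Δ`. -/
def ballClass {V : Type u} {Δ : ℕ} (G : SimpleGraph V)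
    (hG : ∀ x, (G.neighborSet x).encard ≤ Δ) (o : V) (r : ℕ) : Gr.{u} Δ :=
  (rootedBall G hG o r).cls

/-- An isomorphism restricts to balls. -/
def ballIso {V W : Type u} {G : SimpleGraph V} {H : SimpleGraph W} (φ : G ≃g H) (o : V) (r : ℕ) :
    G.induce (closedBall G o r) ≃g H.induce (closedBall H (φ o) r) where
  toEquiv := φ.toEquiv.subtypeEquiv fun x => by
    change G.edist o x ≤ r ↔ H.edist (φ o) (φ x) ≤ r
    rw [edist_iso]
  map_rel_iff' := by
    intro a b
    exact φ.map_adj_iff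

theorem ballClass_iso {V W : Type u} {Δ : ℕ} {G : SimpleGraph V} {H : SimpleGraph W}
    (hG : ∀ x, (G.neighborSet x).encard ≤ Δ) (hH : ∀ x, (H.neighborSet x).encard ≤ Δ)
    (φ : G ≃g H) (o : V) (r : ℕ) : ballClass G hG o r = ballClass H hH (φ o) r :=
  Quotient.sound ⟨ballIso φ o r, rfl⟩

/-- The map `[G, o] ↦ [B_G(o, r), o]`. -/
def Gr.ball {Δ : ℕ} (r : ℕ) : Gr.{u} Δ → Gr.{u} Δ :=
  Quotient.lift (fun R : RootedGraph.{u} Δ => ballClass R.graph R.degree_le R.root r) (by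
    rintro R S ⟨φ, h⟩
    rw [ballClass_iso R.degree_le S.degree_le φ R.root r, h])

/-- An isomorphism between balls of radius zero. -/
def ballZeroIso {V W : Type u} (G : SimpleGraph V) (H : SimpleGraph W) (o : V) (p : W) :
    G.induce (closedBall G o 0) ≃g H.induce (closedBall H p 0) where
  toFun _ := ⟨p, root_mem_closedBall H p 0⟩
  invFun _ := ⟨o, root_mem_closedBall G o 0⟩
  left_inv x := Subtype.ext (by
    have h := x.2
    simp only [closedBall, Set.mem_ofPred_eq, Nat.cast_zero, nonpos_iff_eq_zero,
      SimpleGraph.edist_eq_zero_iff] at h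
    exact h)
  right_inv x := Subtype.ext (by
    have h := x.2
    simp only [closedBall, Set.mem_ofPred_eq, Nat.cast_zero, nonpos_iff_eq_zero,
      SimpleGraph.edist_eq_zero_iff] at h
    exact h)
  map_rel_iff' := by
    rintro ⟨a, ha⟩ ⟨b, hb⟩
    have ha' : a = o := by simpa [closedBall] using ha
    have hb' : b = o := by simpa [closedBall] using hb
    simp [ha', hb']

theorem Gr.ball_zero {Δ : ℕ} (g h : Gr.{u} Δ) : g.ball 0 = h.ball 0 := by
  induction g using Quotient.inductionOn with
  | h R =>
    induction h using Quotient.inductionOn with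
    | h S => exact Quotient.sound ⟨ballZeroIso R.graph S.graph R.root S.root, rfl⟩

/-- `U_r`: the rooted `r`-balls, that is the `[G, o]` with `d_G(o, x) ≤ r` for all vertices `x`. -/
def rootedBalls (Δ r : ℕ) : Set (Gr.{u} Δ) :=
  {α | ∃ R : RootedGraph.{u} Δ, α = R.cls ∧ ∀ x, R.graph.edist R.root x ≤ r}

/-- `T_r(𝐆𝐫, α)`: the `[G, o]` with `[B_G(o, r), o] = α`. -/
def cylinder {Δ : ℕ} (r : ℕ) (α : Gr.{u} Δ) : Set (Gr.{u} Δ) :=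
  {g | g.ball r = α}

open Classical in
/-- The metric `ρ` on `𝐆𝐫`: it is `0` for equal classes, and otherwise `2 ^ (-r)` with `r` the
supremum of the `s` for which the balls of radius `s` around the roots are isomorphic, that is, the
infimum of `2 ^ (-s)` over these `s` (the radius `s = 0` always belongs to them). -/
noncomputable def Gr.rho {Δ : ℕ} (g h : Gr.{u} Δ) : ℝ :=
  if g = h then 0 else ⨅ s : {s : ℕ // g.ball s = h.ball s}, (1 / 2 : ℝ) ^ (s : ℕ)

/-- The topology induced by a distance function: `U` is open when it contains a ball of positive
radius around each of its points. -/
@[reducible]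
def topologyOfDist {α : Type*} (d : α → α → ℝ) : TopologicalSpace α where
  IsOpen U := ∀ x ∈ U, ∃ ε > 0, ∀ y, d x y < ε → y ∈ U
  isOpen_univ := fun _ _ => ⟨1, one_pos, fun _ _ => trivial⟩
  isOpen_inter := by
    rintro s t hs ht x ⟨hxs, hxt⟩
    obtain ⟨ε, hε, h⟩ := hs x hxs
    obtain ⟨δ, hδ, h'⟩ := ht x hxt
    exact ⟨min ε δ, lt_min hε hδ, fun y hy =>
      ⟨h y (lt_of_lt_of_le hy (min_le_left _ _)), h' y (lt_of_lt_of_le hy (min_le_right _ _))⟩⟩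
  isOpen_sUnion := by
    rintro S hS x ⟨t, htS, hxt⟩
    obtain ⟨ε, hε, h⟩ := hS t htS x hxt
    exact ⟨ε, hε, fun y hy => ⟨t, htS, h y hy⟩⟩

noncomputable instance Gr.topologicalSpace (Δ : ℕ) : TopologicalSpace (Gr.{u} Δ) :=
  topologyOfDist Gr.rho

noncomputable instance Gr.measurableSpace (Δ : ℕ) : MeasurableSpace (Gr.{u} Δ) := borel _

instance Gr.borelSpace (Δ : ℕ) : BorelSpace (Gr.{u} Δ) := ⟨rfl⟩

/-! ### Birooted graphs and the space of their isomorphism classes -/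

/-- A countable connected birooted graph with all degrees at most `Δ`: the second root is a neighbour
of the first. -/
structure BirootedGraph (Δ : ℕ) : Type (u + 1) extends RootedGraph.{u} Δ where
  /-- the second root -/
  root₂ : V
  adj : graph.Adj root root₂

/-- Isomorphism of birooted graphs. -/
instance BirootedGraph.setoid (Δ : ℕ) : Setoid (BirootedGraph.{u} Δ) where
  r B C := ∃ φ : B.graph ≃g C.graph, φ B.root = C.root ∧ φ B.root₂ = C.root₂
  iseqv :=
    { refl := fun B => ⟨SimpleGraph.Iso.refl, rfl, rfl⟩
      symm := by
        rintro B C ⟨φ, h, h'⟩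
        exact ⟨φ.symm, by simp [← h], by simp [← h']⟩
      trans := by
        rintro B C D ⟨φ, h, h'⟩ ⟨ψ, k, k'⟩
        exact ⟨φ.trans ψ, by simp [h, k], by simp [h', k']⟩ }

/-- The isomorphism classes `[G, o₁, o₂]` of countable connected birooted graphs with degrees at most
`Δ`. -/
def BiGr (Δ : ℕ) : Type (u + 1) := Quotient (BirootedGraph.setoid.{u} Δ)

/-- The isomorphism class `[G, o₁, o₂]`. -/
def BirootedGraph.cls {Δ : ℕ} (B : BirootedGraph.{u} Δ) : BiGr.{u} Δ := Quotient.mk _ B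

/-- `[B_G(o₁, s), o₁, o₂] = [B_H(p₁, s), p₁, p₂]` for representatives: an isomorphism of the balls
carrying `o₁` to `p₁` and `o₂` to `p₂`. (The second roots lie in the balls as soon as `s ≥ 1`; for
`s = 0` the relation always holds.) -/
def BirootedGraph.BallIso {Δ : ℕ} (s : ℕ) (B C : BirootedGraph.{u} Δ) : Prop :=
  ∃ φ : B.graph.induce (closedBall B.graph B.root s) ≃g
      C.graph.induce (closedBall C.graph C.root s),
    ∀ x : closedBall B.graph B.root s,
      ((x : B.V) = B.root ↔ (φ x : C.V) = C.root) ∧ ((x : B.V) = B.root₂ ↔ (φ x : C.V) = C.root₂)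

/-- `[B_G(o₁, s), o₁, o₂] = [B_H(p₁, s), p₁, p₂]` for isomorphism classes. -/
def BiGr.BallEq {Δ : ℕ} (s : ℕ) (b c : BiGr.{u} Δ) : Prop :=
  ∃ B C : BirootedGraph.{u} Δ, B.cls = b ∧ C.cls = c ∧ B.BallIso s C

open Classical in
/-- The metric on the space of birooted graphs, defined in the same way as `ρ`. -/
noncomputable def BiGr.rho {Δ : ℕ} (b c : BiGr.{u} Δ) : ℝ :=
  if b = c then 0 else ⨅ s : {s : ℕ // b.BallEq s c}, (1 / 2 : ℝ) ^ (s : ℕ)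

noncomputable instance BiGr.topologicalSpace (Δ : ℕ) : TopologicalSpace (BiGr.{u} Δ) :=
  topologyOfDist BiGr.rho

noncomputable instance BiGr.measurableSpace (Δ : ℕ) : MeasurableSpace (BiGr.{u} Δ) := borel _

instance BiGr.borelSpace (Δ : ℕ) : BorelSpace (BiGr.{u} Δ) := ⟨rfl⟩

/-- `(G, o₁, o₂) ↦ (G, o₂, o₁)`. -/
def BirootedGraph.swap {Δ : ℕ} (B : BirootedGraph.{u} Δ) : BirootedGraph.{u} Δ where
  V := B.V
  graph := B.graph
  countable := B.countable
  connected := B.connected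
  degree_le := B.degree_le
  root := B.root₂
  root₂ := B.root
  adj := B.adj.symm

/-- The involution `ι[G, x, y] = [G, y, x]`. -/
def BiGr.swap {Δ : ℕ} : BiGr.{u} Δ → BiGr.{u} Δ :=
  Quotient.map BirootedGraph.swap (by
    rintro B C ⟨φ, h, h'⟩
    exact ⟨φ, h', h⟩)

/-! ### The edge measure of a measure on `𝐆𝐫` -/

/-- The birooted graph `(G, o, x)` for a neighbour `x` of `o`. -/
def RootedGraph.birooted {Δ : ℕ} (R : RootedGraph.{u} Δ) (x : R.V) (h : R.graph.Adj R.root x) :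
    BirootedGraph.{u} Δ where
  toRootedGraph := R
  root₂ := x
  adj := h

/-- The set `{x ∈ N_G(o) : [G, o, x] ∈ A}`. -/
def RootedGraph.edgesIn {Δ : ℕ} (R : RootedGraph.{u} Δ) (A : Set (BiGr.{u} Δ)) : Set R.V :=
  {x | ∃ h : R.graph.Adj R.root x, (R.birooted x h).cls ∈ A}

theorem RootedGraph.edgesIn_encard_le {Δ : ℕ} {R S : RootedGraph.{u} Δ} (h : R ≈ S)
    (A : Set (BiGr.{u} Δ)) : (R.edgesIn A).encard ≤ (S.edgesIn A).encard := by
  obtain ⟨φ, hφ⟩ := h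
  rw [← φ.injective.encard_image]
  apply Set.encard_le_encard
  rintro _ ⟨x, ⟨hx, hA⟩, rfl⟩
  have hadj : S.graph.Adj S.root (φ x) := by rw [← hφ]; exact φ.map_adj_iff.mpr hx
  refine ⟨hadj, ?_⟩
  have : (R.birooted x hx).cls = BirootedGraph.cls (S.birooted (φ x) hadj) :=
    Quotient.sound ⟨φ, hφ, rfl⟩
  exact this ▸ hA

/-- The function `f_A[G, o] = |{x ∈ N_G(o) : [G, o, x] ∈ A}|`. -/
noncomputable def edgeCount {Δ : ℕ} (A : Set (BiGr.{u} Δ)) : Gr.{u} Δ → ℕ∞ :=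
  Quotient.lift (fun R : RootedGraph.{u} Δ => (R.edgesIn A).encard) fun _ _ h =>
    le_antisymm (RootedGraph.edgesIn_encard_le h A)
      (RootedGraph.edgesIn_encard_le (Setoid.symm h) A)

theorem encard_iUnion_eq_tsum {V : Type*} {ι : Type*} [Countable ι] (s : ι → Set V)
    (hs : Pairwise (Function.onFun Disjoint s)) :
    (((⋃ n, s n).encard : ℕ∞) : ℝ≥0∞) = ∑' n, ((s n).encard : ℝ≥0∞) := by
  let _ : MeasurableSpace V := ⊤
  have h : ∀ t : Set V, (t.encard : ℝ≥0∞) = Measure.count t := fun t =>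
    (Measure.count_apply MeasurableSpace.measurableSet_top).symm
  simp only [h]
  exact measure_iUnion hs fun _ => MeasurableSpace.measurableSet_top

theorem edgeCount_iUnion {Δ : ℕ} (A : ℕ → Set (BiGr.{u} Δ))
    (hA : Pairwise (Function.onFun Disjoint A)) (g : Gr.{u} Δ) :
    (edgeCount (⋃ n, A n) g : ℝ≥0∞) = ∑' n, (edgeCount (A n) g : ℝ≥0∞) := by
  induction g using Quotient.inductionOn with
  | h R =>
    change ((R.edgesIn (⋃ n, A n)).encard : ℝ≥0∞) = ∑' n, ((R.edgesIn (A n)).encard : ℝ≥0∞)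
    rw [← encard_iUnion_eq_tsum]
    · congr 2
      ext x
      simp only [RootedGraph.edgesIn, Set.mem_iUnion, Set.mem_ofPred_eq]
      tauto
    · intro m n hmn
      refine Set.disjoint_left.mpr ?_
      rintro x ⟨_, h⟩ ⟨_, h'⟩
      exact Set.disjoint_left.mp (hA hmn) h h'

theorem edgeCount_univ_ne_top {Δ : ℕ} (A : Set (BiGr.{u} Δ)) (g : Gr.{u} Δ) :
    (edgeCount A g : ℝ≥0∞) ≠ ⊤ := by
  induction g using Quotient.inductionOn with
  | h R =>
    have h1 : (R.edgesIn A).encard ≤ Δ :=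
      (Set.encard_le_encard (fun x hx => hx.1)).trans (R.degree_le R.root)
    have h2 : (R.edgesIn A).encard ≠ ⊤ := ne_top_of_le_ne_top (ENat.natCast_ne_top _) h1
    simpa [edgeCount] using h2

theorem exists_edgeCount_le {Δ : ℕ} (U : Set (BiGr.{u} Δ)) (hU : IsOpen U) (g : Gr.{u} Δ) :
    ∃ ε > 0, ∀ h, Gr.rho g h < ε → edgeCount U g ≤ edgeCount U h := by
  induction g using Quotient.inductionOn with
  | h R =>
    change ∃ ε > 0, ∀ h, Gr.rho R.cls h < ε → edgeCount U R.cls ≤ edgeCount U h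
    have hfin : (R.edgesIn U).Finite :=
      Set.finite_of_encard_le_coe
        ((Set.encard_le_encard (fun x hx => hx.1)).trans (R.degree_le R.root))
    have hU' : ∀ x ∈ R.edgesIn U, ∃ ε > (0 : ℝ), ∀ (h : R.graph.Adj R.root x) (c : BiGr.{u} Δ),
        BiGr.rho (R.birooted x h).cls c < ε → c ∈ U := by
      rintro x ⟨h, hx⟩
      obtain ⟨ε, hε, hb⟩ := hU _ hx
      exact ⟨ε, hε, fun _ c hc => hb c hc⟩
    have hmin : ∃ ε > (0 : ℝ), ∀ x ∈ R.edgesIn U, ∀ (h : R.graph.Adj R.root x) (c : BiGr.{u} Δ),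
        BiGr.rho (R.birooted x h).cls c < ε → c ∈ U := by
      choose! e he hb using hU'
      have : Finite (R.edgesIn U) := hfin
      obtain ⟨δ, hδ, hle⟩ : ∃ δ > (0 : ℝ), ∀ x ∈ hfin.toFinset, δ ≤ e x := by
        rcases hfin.toFinset.eq_empty_or_nonempty with h0 | h0
        · exact ⟨1, one_pos, by simp [h0]⟩
        · obtain ⟨m, hm, hmin⟩ := hfin.toFinset.exists_min_image e h0
          exact ⟨e m, he m (by simpa using hm), hmin⟩
      refine ⟨δ, hδ, fun x hx h c hc => hb x hx h c ?_⟩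
      exact hc.trans_le (hle x (by simpa using hx))
    obtain ⟨ε, hε, hb⟩ := hmin
    refine ⟨min ε 1, lt_min hε one_pos, ?_⟩
    intro h hh
    by_cases hgh : R.cls = h
    · exact hgh ▸ le_rfl
    rw [Gr.rho, if_neg hgh] at hh
    have : Nonempty {s : ℕ // R.cls.ball s = h.ball s} := ⟨0, Gr.ball_zero R.cls h⟩
    obtain ⟨⟨s, hs⟩, hlt⟩ := exists_lt_of_ciInf_lt hh
    have hs1 : 1 ≤ s := by
      by_contra h0
      have : s = 0 := by omega
      subst this
      simp at hlt
    induction h using Quotient.inductionOn with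
    | h S =>
      obtain ⟨φ, hφ⟩ : ∃ φ : R.graph.induce (closedBall R.graph R.root s) ≃g
          S.graph.induce (closedBall S.graph S.root s),
          φ ⟨R.root, root_mem_closedBall _ _ _⟩ = ⟨S.root, root_mem_closedBall _ _ _⟩ :=
        Quotient.exact hs
      have hmem : ∀ x, R.graph.Adj R.root x → x ∈ closedBall R.graph R.root s := by
        intro x hx
        calc R.graph.edist R.root x = 1 := SimpleGraph.edist_eq_one_iff_adj.mpr hx
          _ ≤ s := by exact_mod_cast hs1
      change (R.edgesIn U).encard ≤ (S.edgesIn U).encard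
      classical
      let f : R.V → S.V := fun x =>
        if hx : x ∈ closedBall R.graph R.root s then (φ ⟨x, hx⟩ : S.V) else S.root
      have hf : ∀ x (hx : x ∈ closedBall R.graph R.root s), f x = φ ⟨x, hx⟩ := fun x hx => dif_pos hx
      have hinj : Set.InjOn f (R.edgesIn U) := by
        intro x hx y hy hxy
        rw [hf x (hmem x hx.1), hf y (hmem y hy.1)] at hxy
        exact congrArg Subtype.val (φ.injective (Subtype.ext hxy))
      rw [← hinj.encard_image]
      apply Set.encard_le_encard
      rintro _ ⟨x, hx, rfl⟩
      have hx' := hmem x hx.1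
      have hadj : S.graph.Adj S.root (f x) := by
        have h1 : (R.graph.induce (closedBall R.graph R.root s)).Adj
            ⟨R.root, root_mem_closedBall _ _ _⟩ ⟨x, hx'⟩ := hx.1
        have h2 := φ.map_adj_iff.mpr h1
        rw [hφ] at h2
        rw [hf x hx']
        exact h2
      refine ⟨hadj, hb x hx hx.1 _ ?_⟩
      have hball : BiGr.BallEq s (BirootedGraph.cls (R.birooted x hx.1))
          (BirootedGraph.cls (S.birooted (f x) hadj)) := by
        refine ⟨_, _, rfl, rfl, φ, fun (y : closedBall R.graph R.root s) => ⟨?_, ?_⟩⟩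
        · change (y : R.V) = R.root ↔ (φ y : S.V) = S.root
          have e : φ y = φ ⟨R.root, root_mem_closedBall _ _ _⟩ ↔ (φ y : S.V) = S.root := by
            rw [hφ]
            exact Subtype.ext_iff
          rw [← e, φ.injective.eq_iff, Subtype.ext_iff]
        · change (y : R.V) = x ↔ (φ y : S.V) = f x
          rw [hf x hx', ← Subtype.ext_iff, φ.injective.eq_iff, Subtype.ext_iff]
      refine lt_of_le_of_lt ?_ (hlt.trans_le (min_le_left _ _))
      rw [BiGr.rho]
      split_ifs with heq
      · positivity
      · exact ciInf_le ⟨0, by rintro _ ⟨t, rfl⟩; positivity⟩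
          (⟨s, hball⟩ : {s : ℕ // BiGr.BallEq s _ _})

theorem measurable_edgeCount {Δ : ℕ} (A : Set (BiGr.{u} Δ)) (hA : MeasurableSet A) :
    Measurable fun g : Gr.{u} Δ => (edgeCount A g : ℝ≥0∞) := by
  have hopen : ∀ U : Set (BiGr.{u} Δ), IsOpen U →
      Measurable fun g : Gr.{u} Δ => (edgeCount U g : ℝ≥0∞) := by
    intro U hU
    refine measurable_of_Ioi fun y => IsOpen.measurableSet ?_
    intro g hg
    obtain ⟨ε, hε, h⟩ := exists_edgeCount_le U hU g
    refine ⟨ε, hε, fun g' hg' => ?_⟩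
    have : (edgeCount U g : ℝ≥0∞) ≤ edgeCount U g' := by exact_mod_cast h g' hg'
    exact lt_of_lt_of_le hg this
  refine MeasurableSpace.induction_on_inter
    (C := fun A _ => Measurable fun g : Gr.{u} Δ => (edgeCount A g : ℝ≥0∞))
    (s := {U | IsOpen U}) rfl isPiSystem_isOpen ?_ ?_ ?_ ?_ A hA
  · exact hopen ∅ isOpen_empty
  · exact fun U hU => hopen U hU
  · intro t _ ih
    have h : ∀ g : Gr.{u} Δ,
        (edgeCount tᶜ g : ℝ≥0∞) = (edgeCount Set.univ g : ℝ≥0∞) - (edgeCount t g : ℝ≥0∞) := by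
      intro g
      refine ENNReal.eq_sub_of_add_eq (edgeCount_univ_ne_top t g) ?_
      induction g using Quotient.inductionOn with
      | h R =>
        change ((R.edgesIn tᶜ).encard : ℝ≥0∞) + ((R.edgesIn t).encard : ℝ≥0∞) =
          ((R.edgesIn Set.univ).encard : ℝ≥0∞)
        rw [← ENat.toENNReal_add, ← Set.encard_union_eq]
        · congr 2
          ext x
          simp only [RootedGraph.edgesIn, Set.mem_union, Set.mem_ofPred_eq, Set.mem_compl_iff,
            Set.mem_univ]
          constructor
          · rintro (⟨h, _⟩ | ⟨h, _⟩) <;> exact ⟨h, trivial⟩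
          · rintro ⟨h, _⟩
            by_cases hm : (R.birooted x h).cls ∈ t
            · exact Or.inr ⟨h, hm⟩
            · exact Or.inl ⟨h, hm⟩
        · refine Set.disjoint_left.mpr ?_
          rintro x ⟨_, h⟩ ⟨_, h'⟩
          exact h h'
    simp only [h]
    exact (hopen _ isOpen_univ).sub ih
  · intro f hd _ ih
    simp only [edgeCount_iUnion f hd]
    exact Measurable.tsum ih

/-- The edge measure of a measure `μ` on `𝐆𝐫`: the measure on the space of birooted graphs whose value
at a Borel set `A` is `∫ f_A dμ`. -/
noncomputable def edgeMeasure {Δ : ℕ} (μ : Measure (Gr.{u} Δ)) : Measure (BiGr.{u} Δ) :=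
  Measure.ofMeasurable (fun A _ => ∫⁻ g, (edgeCount A g : ℝ≥0∞) ∂μ)
    (by
      have h : ∀ g : Gr.{u} Δ, edgeCount ∅ g = 0 := by
        intro g
        induction g using Quotient.inductionOn with
        | h R =>
          change (R.edgesIn ∅).encard = 0
          simp [RootedGraph.edgesIn]
      simp [h])
    (by
      intro f hf hd
      simp only [edgeCount_iUnion f hd]
      exact lintegral_tsum fun n => (measurable_edgeCount (f n) (hf n)).aemeasurable)

theorem edgeMeasure_apply {Δ : ℕ} (μ : Measure (Gr.{u} Δ)) {A : Set (BiGr.{u} Δ)}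
    (hA : MeasurableSet A) : edgeMeasure μ A = ∫⁻ g, (edgeCount A g : ℝ≥0∞) ∂μ :=
  Measure.ofMeasurable_apply A hA

/-- A measure `μ` on `𝐆𝐫` is involution invariant when its edge measure is invariant under `ι`. -/
def IsInvolutionInvariant {Δ : ℕ} (μ : Measure (Gr.{u} Δ)) : Prop :=
  Measure.map BiGr.swap (edgeMeasure μ) = edgeMeasure μ

/-! ### Measurable graphings -/

/-- A measurable graphing `(X, i₁, …, i_k, μ)`: finitely many measure-preserving Borel involutions of
a probability space (fixed points are allowed). -/
structure MeasurableGraphing (X : Type u) [MeasurableSpace X] (k : ℕ) where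
  /-- the involutions -/
  i : Fin k → X → X
  /-- the measure -/
  μ : Measure X
  isProbabilityMeasure : IsProbabilityMeasure μ
  involutive : ∀ j, Function.Involutive (i j)
  measurePreserving : ∀ j, MeasurePreserving (i j) μ μ

namespace MeasurableGraphing

variable {X : Type u} [MeasurableSpace X] {k : ℕ}

/-- The leafgraph: distinct points `x`, `y` are adjacent when `y = i_j(x)` for some `j`. -/
def leafgraph (𝒢 : MeasurableGraphing X k) : SimpleGraph X where
  Adj x y := x ≠ y ∧ ∃ j, y = 𝒢.i j x
  symm := ⟨by
    rintro x y ⟨hne, j, rfl⟩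
    exact ⟨hne.symm, j, (𝒢.involutive j x).symm⟩⟩
  loopless := ⟨fun _ h => h.1 rfl⟩

/-- `Ψ` is the law of the graphing `𝒢` (whose leafgraph has degrees at most `Δ`): a probability
measure on `𝐆𝐫` with `Ψ(T_r(𝐆𝐫, α)) = μ {x : [B_𝓛(x, r), x] = α}` for all `r` and all rooted
`r`-balls `α`. -/
def IsLaw {Δ : ℕ} (𝒢 : MeasurableGraphing X k)
    (hΔ : ∀ x, (𝒢.leafgraph.neighborSet x).encard ≤ Δ) (Ψ : Measure (Gr.{u} Δ)) : Prop :=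
  IsProbabilityMeasure Ψ ∧ ∀ (r : ℕ), ∀ α ∈ rootedBalls.{u} Δ r,
    Ψ (cylinder r α) = 𝒢.μ {x | ballClass 𝒢.leafgraph hΔ x r = α}

/-- The set `S_𝓛` of pairs `(x, y)` of adjacent vertices of the leafgraph. -/
def edgeSet (𝒢 : MeasurableGraphing X k) : Set (X × X) :=
  {p | 𝒢.leafgraph.Adj p.1 p.2}

/-- The set `{y ∈ N_𝓛(x) : (x, y) ∈ B}`, for `B ⊆ S_𝓛`. -/
def edgesIn (𝒢 : MeasurableGraphing X k) (B : Set 𝒢.edgeSet) (x : X) : Set X :=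
  {y | ∃ h : 𝒢.leafgraph.Adj x y, (⟨(x, y), h⟩ : 𝒢.edgeSet) ∈ B}

theorem edgesIn_iUnion (𝒢 : MeasurableGraphing X k) (B : ℕ → Set 𝒢.edgeSet)
    (hB : Pairwise (Function.onFun Disjoint B)) (x : X) :
    ((𝒢.edgesIn (⋃ n, B n) x).encard : ℝ≥0∞) = ∑' n, ((𝒢.edgesIn (B n) x).encard : ℝ≥0∞) := by
  rw [← encard_iUnion_eq_tsum]
  · congr 2
    ext y
    simp only [edgesIn, Set.mem_iUnion, Set.mem_ofPred_eq]
    tauto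
  · intro m n hmn
    refine Set.disjoint_left.mpr ?_
    rintro y ⟨_, h⟩ ⟨_, h'⟩
    exact Set.disjoint_left.mp (hB hmn) h h'

theorem measurable_edgesIn [StandardBorelSpace X] (𝒢 : MeasurableGraphing X k)
    (B : Set 𝒢.edgeSet) (hB : MeasurableSet B) :
    Measurable fun x => ((𝒢.edgesIn B x).encard : ℝ≥0∞) := by
  classical
  obtain ⟨B', hB', rfl⟩ := hB
  let P : Fin k → Set X := fun j =>
    {x | x ≠ 𝒢.i j x ∧ (∀ l, l < j → 𝒢.i l x ≠ 𝒢.i j x) ∧ (x, 𝒢.i j x) ∈ B'}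
  have hi : ∀ j, Measurable (𝒢.i j) := fun j => (𝒢.measurePreserving j).measurable
  have hP : ∀ j, MeasurableSet (P j) := by
    intro j
    refine (measurableSet_eq_fun measurable_id (hi j)).compl.inter (MeasurableSet.inter ?_ ?_)
    · change MeasurableSet {x | ∀ l, l < j → 𝒢.i l x ≠ 𝒢.i j x}
      simp only [Set.ofPred_forall]
      exact MeasurableSet.iInter fun l => MeasurableSet.iInter fun _ =>
        (measurableSet_eq_fun (hi l) (hi j)).compl
    · exact (measurable_id.prodMk (hi j)) hB'
  have key : ∀ x, ((𝒢.edgesIn (Subtype.val ⁻¹' B') x).encard : ℝ≥0∞) =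
      ∑ j, (P j).indicator (fun _ => (1 : ℝ≥0∞)) x := by
    intro x
    have hU : 𝒢.edgesIn (Subtype.val ⁻¹' B') x = ⋃ j, {y | y = 𝒢.i j x ∧ x ∈ P j} := by
      ext y
      simp only [Set.mem_iUnion, Set.mem_ofPred_eq]
      constructor
      · rintro ⟨⟨hne, hj⟩, hmem⟩
        have hex : ∃ n : ℕ, ∃ h : n < k, y = 𝒢.i ⟨n, h⟩ x := by
          obtain ⟨j, hj⟩ := hj
          exact ⟨j, j.2, hj⟩
        obtain ⟨hk, hn⟩ := Nat.find_spec hex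
        refine ⟨⟨Nat.find hex, hk⟩, hn, hn ▸ hne, ?_, hn ▸ hmem⟩
        intro l hl heq
        exact Nat.find_min hex hl ⟨l.2, hn.trans heq.symm⟩
      · rintro ⟨j, rfl, hne, _, hmem⟩
        exact ⟨⟨hne, j, rfl⟩, hmem⟩
    rw [hU, encard_iUnion_eq_tsum, tsum_fintype]
    · refine Finset.sum_congr rfl fun j _ => ?_
      by_cases hx : x ∈ P j
      · simp [hx]
      · simp [hx]
    · intro j l hjl
      refine Set.disjoint_left.mpr ?_
      rintro y ⟨hy, hj⟩ ⟨hy', hl⟩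
      rcases lt_or_gt_of_ne hjl with h | h
      · exact hl.2.1 j h (hy.symm.trans hy')
      · exact hj.2.1 l h (hy'.symm.trans hy)
  simp only [key]
  exact Finset.measurable_sum _ fun j _ => measurable_const.indicator (hP j)

/-- The edge measure of a graphing: the measure on `S_𝓛` whose value at a Borel set `B` is
`∫ |{y ∈ N_𝓛(x) : (x, y) ∈ B}| dμ(x)`. -/
noncomputable def edgeMeasure [StandardBorelSpace X] (𝒢 : MeasurableGraphing X k) :
    Measure 𝒢.edgeSet :=
  Measure.ofMeasurable (fun B _ => ∫⁻ x, ((𝒢.edgesIn B x).encard : ℝ≥0∞) ∂𝒢.μ)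
    (by simp [edgesIn])
    (by
      intro f hf hd
      simp only [edgesIn_iUnion 𝒢 f hd]
      exact lintegral_tsum fun n => (measurable_edgesIn 𝒢 (f n) (hf n)).aemeasurable)

theorem edgeMeasure_apply [StandardBorelSpace X] (𝒢 : MeasurableGraphing X k)
    {B : Set 𝒢.edgeSet} (hB : MeasurableSet B) :
    𝒢.edgeMeasure B = ∫⁻ x, ((𝒢.edgesIn B x).encard : ℝ≥0∞) ∂𝒢.μ :=
  Measure.ofMeasurable_apply B hB

/-- The involution `(x, y) ↦ (y, x)` of `S_𝓛`. -/
def edgeSwap (𝒢 : MeasurableGraphing X k) (p : 𝒢.edgeSet) : 𝒢.edgeSet :=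
  ⟨(p.1.2, p.1.1), 𝒢.leafgraph.adj_symm p.2⟩

/-- The measure `μ` of a graphing is involution invariant when its edge measure is invariant under
`(x, y) ↦ (y, x)`. -/
def IsInvolutionInvariant [StandardBorelSpace X] (𝒢 : MeasurableGraphing X k) : Prop :=
  Measure.map 𝒢.edgeSwap 𝒢.edgeMeasure = 𝒢.edgeMeasure

end MeasurableGraphing

end Graphings

namespace Graphings

/-! ### Balls in induced subgraphs -/

/-! The law is the push-forward of `μ` under the map sending `x` to its component in the leafgraph,
rooted at `x`: a ball of the component around `x` is a ball of the leafgraph, so the defining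
equations hold once this map is known to be Borel (`isLaw_map`). It is the only measure with these
values on cylinders, because the cylinders form a countable π-system generating the Borel σ-algebra
(`borel_eq_generateFrom_cylinders`, `isPiSystem_cylinders`); countability comes from the degree
bound, which makes all balls finite.

Measurability rests on a finite encoding. Every point of the ball of radius `n` around `x` is the
image of `x` under a word of length at most `n` in the involutions, and the coincidences among the
images of `x` under words of length at most `n + 1` determine the ball up to rooted isomorphism
(`exists_iso_of_wordType_eq`). Each coincidence is a Borel condition on `x`, since the diagonal of a
standard Borel space is Borel. For a birooted component, one records in addition which involutions
carry the first root to the second.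

The map from edges to birooted components pushes the edge measure of the graphing to the edge
measure of the law and intertwines the two swaps. Hence symmetry passes from `μ` to the law. It
cannot simply be pulled back in the other direction, since the map may identify different edges; but
no pulling back is needed, because `μ` is always involution invariant (`isInvolutionInvariant`).
Indeed, attribute each edge `(x, y)` to the least `j` with `y = i_j x`. As the `i_l` are
involutions, `(y, x)` is attributed to the same `j`, so the edge measure splits into finitely many
pieces, and on each the swap is implemented by the `μ`-preserving map `i_j`. -/

theorem closedBall_mono {V : Type u} (G : SimpleGraph V) (o : V) {r s : ℕ} (h : r ≤ s) :
    closedBall G o r ⊆ closedBall G o s := fun _ hx =>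
  le_trans (show G.edist o _ ≤ r from hx) (by exact_mod_cast h)

theorem closedBall_subset_of_adj {V : Type u} {G : SimpleGraph V} {o p : V} (h : G.Adj o p)
    (r : ℕ) : closedBall G p r ⊆ closedBall G o (r + 1) := by
  intro x hx
  have hx' : G.edist p x ≤ r := hx
  calc G.edist o x ≤ G.edist o p + G.edist p x := G.edist_triangle
    _ ≤ 1 + r := add_le_add (SimpleGraph.edist_eq_one_iff_adj.mpr h).le hx'
    _ = ((r + 1 : ℕ) : ℕ∞) := by push_cast; rw [add_comm]

theorem exists_walk_of_mem_closedBall {V : Type u} {G : SimpleGraph V} {o x : V} {r : ℕ}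
    (h : x ∈ closedBall G o r) : ∃ p : G.Walk o x, p.length ≤ r := by
  have h' : G.edist o x ≤ r := h
  obtain ⟨p, hp⟩ := SimpleGraph.exists_walk_of_edist_ne_top
    (ne_top_of_le_ne_top (ENat.natCast_ne_top r) h')
  exact ⟨p, by rw [← hp] at h'; exact_mod_cast h'⟩

/-- Passing to a subgraph can only increase distances. Conversely, a walk of length at most `r` from
`o` visits only points at distance at most `r` from `o`, so it never leaves `S`. -/
theorem mem_closedBall_induce {V : Type u} {G : SimpleGraph V} {S : Set V} {o : S} {r : ℕ}
    (hS : closedBall G o r ⊆ S) (x : S) :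
    x ∈ closedBall (G.induce S) o r ↔ (x : V) ∈ closedBall G o r := by
  constructor
  · intro hx
    exact le_trans (edist_map_le (SimpleGraph.Embedding.induce S).toHom o x) hx
  · intro hx
    obtain ⟨p, hp⟩ := exists_walk_of_mem_closedBall hx
    have hs : ∀ z ∈ p.support, z ∈ S := by
      classical
      intro z hz
      apply hS
      calc G.edist o z ≤ (p.takeUntil z hz).length := SimpleGraph.edist_le _
        _ ≤ p.length := by exact_mod_cast p.length_takeUntil_le_length hz
        _ ≤ r := by exact_mod_cast hp
    calc (G.induce S).edist o x ≤ (p.induce S hs).length := SimpleGraph.edist_le _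
      _ ≤ r := by
        have h := congrArg List.length (SimpleGraph.Walk.support_induce p hs)
        simp only [SimpleGraph.Walk.length_support, List.length_attachWith] at h
        exact_mod_cast (Nat.succ_injective h).trans_le hp

/-- If the ball of radius `r` around `o` lies in `S`, then it is also the ball of radius `r` around
`o` in the subgraph induced by `S`. -/
def induceBallIso {V : Type u} {G : SimpleGraph V} {S : Set V} (o : S) (r : ℕ)
    (hS : closedBall G o r ⊆ S) :
    (G.induce S).induce (closedBall (G.induce S) o r) ≃g G.induce (closedBall G o r) where
  toFun x := ⟨x.1.1, (mem_closedBall_induce hS x.1).mp x.2⟩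
  invFun x := ⟨⟨x.1, hS x.2⟩, (mem_closedBall_induce hS ⟨x.1, hS x.2⟩).mpr x.2⟩
  left_inv _ := rfl
  right_inv _ := rfl
  map_rel_iff' := Iff.rfl

/-- An isomorphism of induced subgraphs restricts to the balls that they contain. -/
theorem exists_iso_closedBall {V W : Type u} {G : SimpleGraph V} {H : SimpleGraph W} {S : Set V}
    {T : Set W} (φ : G.induce S ≃g H.induce T) {o : V} {p : W} {r : ℕ}
    (hS : closedBall G o r ⊆ S) (hT : closedBall H p r ⊆ T)
    (hp : (φ ⟨o, hS (root_mem_closedBall G o r)⟩ : W) = p) :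
    ∃ ψ : G.induce (closedBall G o r) ≃g H.induce (closedBall H p r),
      ∀ x : closedBall G o r, (ψ x : W) = φ ⟨x, hS x.2⟩ := by
  subst hp
  exact ⟨((induceBallIso ⟨o, hS (root_mem_closedBall G o r)⟩ r hS).symm.trans (ballIso φ _ r)).trans
    (induceBallIso (φ _) r hT), fun _ => rfl⟩

/-! ### Cylinders and the Borel structure of `𝐆𝐫` -/

theorem Gr.ball_eq_of_le {Δ : ℕ} {g h : Gr.{u} Δ} {r s : ℕ} (hrs : r ≤ s)
    (hs : g.ball s = h.ball s) : g.ball r = h.ball r := by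
  induction g using Quotient.inductionOn with
  | h R =>
    induction h using Quotient.inductionOn with
    | h S =>
      obtain ⟨φ, hφ⟩ : ∃ φ : R.graph.induce (closedBall R.graph R.root s) ≃g
          S.graph.induce (closedBall S.graph S.root s),
          φ ⟨R.root, root_mem_closedBall _ _ _⟩ = ⟨S.root, root_mem_closedBall _ _ _⟩ :=
        Quotient.exact hs
      obtain ⟨ψ, hψ⟩ := exists_iso_closedBall φ (closedBall_mono _ _ hrs)
        (closedBall_mono _ _ hrs) (congrArg Subtype.val hφ)
      exact Quotient.sound ⟨ψ, Subtype.ext ((hψ _).trans (congrArg Subtype.val hφ))⟩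

theorem Gr.ball_mem_rootedBalls {Δ : ℕ} (g : Gr.{u} Δ) (r : ℕ) : g.ball r ∈ rootedBalls Δ r := by
  induction g using Quotient.inductionOn with
  | h R =>
    exact ⟨rootedBall R.graph R.degree_le R.root r, rfl, fun x =>
      (mem_closedBall_induce (o := ⟨R.root, root_mem_closedBall _ _ _⟩) subset_rfl x).mpr x.2⟩

/-- The common shape of both metrics, with `E s` standing for agreement of the balls of radius `s`.
Together with `dist_le_pow` it replaces distances by agreement of balls. -/
theorem exists_pow_lt_of_dist_lt {α : Type*} [DecidableEq α] {E : ℕ → α → α → Prop} {x y : α}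
    (h0 : E 0 x y) (hrefl : ∀ s, E s x x) {r : ℕ}
    (h : (if x = y then 0 else ⨅ s : {s : ℕ // E s x y}, (1 / 2 : ℝ) ^ (s : ℕ)) < (1 / 2) ^ r) :
    ∃ s, r < s ∧ E s x y := by
  split_ifs at h with hxy
  · exact ⟨r + 1, by omega, hxy ▸ hrefl _⟩
  · have : Nonempty {s : ℕ // E s x y} := ⟨0, h0⟩
    obtain ⟨⟨s, hs⟩, hlt⟩ := exists_lt_of_ciInf_lt h
    exact ⟨s, (pow_lt_pow_iff_right_of_lt_one₀ (by norm_num) (by norm_num)).mp hlt, hs⟩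

theorem dist_le_pow {α : Type*} [DecidableEq α] {E : ℕ → α → α → Prop} {x y : α} {r : ℕ}
    (h : E r x y) :
    (if x = y then 0 else ⨅ s : {s : ℕ // E s x y}, (1 / 2 : ℝ) ^ (s : ℕ)) ≤ (1 / 2) ^ r := by
  split_ifs
  · positivity
  · exact ciInf_le ⟨0, by rintro _ ⟨t, rfl⟩; positivity⟩ (⟨r, h⟩ : {s : ℕ // E s x y})

theorem Gr.ball_eq_of_rho_lt {Δ : ℕ} {g h : Gr.{u} Δ} {r : ℕ} (hr : g.rho h < (1 / 2) ^ r) :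
    g.ball r = h.ball r := by
  classical
  obtain ⟨s, hrs, hs⟩ := exists_pow_lt_of_dist_lt (E := fun s g h => Gr.ball s g = Gr.ball s h)
    (Gr.ball_zero g h) (fun _ => rfl) (by convert hr using 1; simp only [Gr.rho])
  exact ball_eq_of_le hrs.le hs

theorem Gr.rho_le_of_ball_eq {Δ : ℕ} {g h : Gr.{u} Δ} {r : ℕ} (hr : g.ball r = h.ball r) :
    g.rho h ≤ (1 / 2) ^ r := by
  classical
  exact dist_le_pow (E := fun s g h => Gr.ball s g = Gr.ball s h) hr

theorem exists_half_pow_lt {ε : ℝ} (hε : 0 < ε) : ∃ n : ℕ, (1 / 2 : ℝ) ^ n < ε :=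
  exists_pow_lt_of_lt_one hε (by norm_num)

theorem Gr.exists_ball_subset {Δ : ℕ} {U : Set (Gr.{u} Δ)} (hU : IsOpen U) {g : Gr.{u} Δ}
    (hg : g ∈ U) : ∃ n : ℕ, ∀ h : Gr.{u} Δ, g.ball n = h.ball n → h ∈ U := by
  obtain ⟨ε, hε, h⟩ := hU g hg
  obtain ⟨n, hn⟩ := exists_half_pow_lt hε
  exact ⟨n, fun k hk => h k ((Gr.rho_le_of_ball_eq hk).trans_lt hn)⟩

theorem isOpen_cylinder {Δ : ℕ} (r : ℕ) (α : Gr.{u} Δ) : IsOpen (cylinder r α) := fun g hg =>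
  ⟨(1 / 2) ^ r, by positivity, fun _ hh => (Gr.ball_eq_of_rho_lt hh).symm.trans hg⟩

theorem measurableSet_cylinder {Δ : ℕ} (r : ℕ) (α : Gr.{u} Δ) : MeasurableSet (cylinder r α) :=
  (isOpen_cylinder r α).measurableSet

/-- A finite rooted graph can be transported to some `Fin n`, and the transported graph with its
root determines the class. There are only countably many such pairs. -/
theorem countable_finite_classes (Δ : ℕ) :
    {α : Gr.{u} Δ | ∃ R : RootedGraph.{u} Δ, R.cls = α ∧ Finite R.V}.Countable := by
  have h : ∀ α : {α : Gr.{u} Δ | ∃ R : RootedGraph.{u} Δ, R.cls = α ∧ Finite R.V},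
      ∃ t : Σ n : ℕ, SimpleGraph (Fin n) × Fin n, ∃ R : RootedGraph.{u} Δ, R.cls = α ∧
        ∃ φ : R.graph ≃g t.2.1, φ R.root = t.2.2 := by
    rintro ⟨_, R, rfl, hR⟩
    obtain ⟨n, ⟨e⟩⟩ := Finite.exists_equiv_fin R.V
    exact ⟨⟨n, R.graph.map e.toEmbedding, e R.root⟩, R, rfl, SimpleGraph.Iso.map e R.graph, rfl⟩
  choose f R hR φ hφ using h
  refine Set.countable_coe_iff.mp (Function.Injective.countable (f := f) ?_)
  intro α β hαβ
  apply Subtype.ext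
  rw [← hR α, ← hR β]
  obtain ⟨ψ, hψ⟩ : ∃ ψ : (R α).graph ≃g (f β).2.1, ψ (R α).root = (f β).2.2 :=
    hαβ ▸ ⟨φ α, hφ α⟩
  exact Quotient.sound ⟨ψ.trans (φ β).symm, (RelIso.symm_apply_eq _).mpr (hψ.trans (hφ β).symm)⟩

theorem countable_range_ball (Δ r : ℕ) :
    (Set.range (Gr.ball (Δ := Δ) r : Gr.{u} Δ → _)).Countable := by
  refine (countable_finite_classes.{u} Δ).mono ?_
  rintro _ ⟨g, rfl⟩
  induction g using Quotient.inductionOn with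
  | h R =>
    exact ⟨rootedBall R.graph R.degree_le R.root r, rfl,
      (closedBall_finite R.graph R.degree_le R.root r).to_subtype⟩

/-- The cylinders around the points of `𝐆𝐫`. -/
def cylinders (Δ : ℕ) : Set (Set (Gr.{u} Δ)) :=
  {C | ∃ (r : ℕ) (g : Gr.{u} Δ), C = cylinder r (g.ball r)}

/-- Cylinders behave like balls of an ultrametric: any point of a cylinder is a centre of it. Two
cylinders with a common point `k` therefore meet in the cylinder around `k` of the larger radius. -/
theorem isPiSystem_cylinders (Δ : ℕ) : IsPiSystem (cylinders.{u} Δ) := by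
  rintro _ ⟨r, g, rfl⟩ _ ⟨s, h, rfl⟩ ⟨k, hk, hk'⟩
  have hk : k.ball r = g.ball r := hk
  have hk' : k.ball s = h.ball s := hk'
  refine ⟨max r s, k, ?_⟩
  ext l
  simp only [cylinder, Set.mem_inter_iff, Set.mem_ofPred_eq, ← hk, ← hk']
  constructor
  · rintro ⟨h1, h2⟩
    rcases le_total r s with hrs | hrs
    · rwa [max_eq_right hrs]
    · rwa [max_eq_left hrs]
  · exact fun h => ⟨Gr.ball_eq_of_le (le_max_left _ _) h, Gr.ball_eq_of_le (le_max_right _ _) h⟩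

theorem countable_cylinders (Δ : ℕ) : (cylinders.{u} Δ).Countable := by
  have : cylinders.{u} Δ = ⋃ r : ℕ, cylinder r '' Set.range (Gr.ball r) := by
    ext C
    simp only [cylinders, Set.mem_ofPred_eq, Set.mem_iUnion, Set.mem_image, Set.mem_range,
      exists_exists_eq_and, eq_comm (a := C)]
  rw [this]
  exact Set.countable_iUnion fun r => (countable_range_ball Δ r).image _

/-- The cylinders are a countable base of open sets, so every open set is a countable union of them.
-/
theorem borel_eq_generateFrom_cylinders (Δ : ℕ) :
    Gr.measurableSpace.{u} Δ = MeasurableSpace.generateFrom (cylinders.{u} Δ) := by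
  apply le_antisymm
  · refine MeasurableSpace.generateFrom_le fun U (hU : IsOpen U) => ?_
    have : U = ⋃₀ {C ∈ cylinders.{u} Δ | C ⊆ U} := by
      apply Set.Subset.antisymm
      · intro g hg
        obtain ⟨n, hn⟩ := Gr.exists_ball_subset hU hg
        exact ⟨cylinder n (g.ball n), ⟨⟨n, g, rfl⟩, fun h hh => hn h (Eq.symm hh)⟩, rfl⟩
      · exact Set.sUnion_subset fun C hC => hC.2
    rw [this]
    exact MeasurableSet.sUnion ((countable_cylinders Δ).mono fun C hC => hC.1)
      fun C hC => MeasurableSpace.measurableSet_generateFrom hC.1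
  · refine MeasurableSpace.generateFrom_le ?_
    rintro _ ⟨r, g, rfl⟩
    exact measurableSet_cylinder r _

/-! ### The space of birooted graphs -/

theorem BirootedGraph.ballIso_refl {Δ : ℕ} (s : ℕ) (B : BirootedGraph.{u} Δ) : B.BallIso s B :=
  ⟨SimpleGraph.Iso.refl, fun _ => ⟨Iff.rfl, Iff.rfl⟩⟩

theorem BiGr.ballEq_refl {Δ : ℕ} (s : ℕ) (b : BiGr.{u} Δ) : b.BallEq s b := by
  induction b using Quotient.inductionOn with
  | h B => exact ⟨B, B, rfl, rfl, B.ballIso_refl s⟩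

theorem BiGr.ballEq_zero {Δ : ℕ} (b c : BiGr.{u} Δ) : b.BallEq 0 c := by
  induction b using Quotient.inductionOn with
  | h B =>
    induction c using Quotient.inductionOn with
    | h C =>
      refine ⟨B, C, rfl, rfl, ballZeroIso B.graph C.graph B.root C.root, fun x => ?_⟩
      have hx : (x : B.V) = B.root := by
        have h := x.2
        simp only [closedBall, Set.mem_ofPred_eq, Nat.cast_zero, nonpos_iff_eq_zero,
          SimpleGraph.edist_eq_zero_iff] at h
        exact h.symm
      have hφ : (ballZeroIso B.graph C.graph B.root C.root x : C.V) = C.root := rfl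
      -- A ball of radius `0` contains only the first root, which differs from the second, so the
      -- condition on second roots reads false on both sides.
      simp [hx, hφ, B.adj.ne, C.adj.ne]

theorem BirootedGraph.BallIso.of_le {Δ r s : ℕ} {B C : BirootedGraph.{u} Δ} (hrs : r ≤ s)
    (h : B.BallIso s C) : B.BallIso r C := by
  obtain ⟨φ, hφ⟩ := h
  obtain ⟨ψ, hψ⟩ := exists_iso_closedBall φ (closedBall_mono _ _ hrs)
    (closedBall_mono _ _ hrs) ((hφ ⟨B.root, root_mem_closedBall _ _ _⟩).1.mp rfl)
  refine ⟨ψ, fun x => ?_⟩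
  rw [hψ x]
  exact hφ ⟨x, closedBall_mono _ _ hrs x.2⟩

/-- The ball of radius `s` around the second root lies in the ball of radius `s + 1` around the
first. Exchanging the roots thus costs one unit of radius, which is what makes `BiGr.swap`
continuous. -/
theorem BirootedGraph.BallIso.swap {Δ s : ℕ} {B C : BirootedGraph.{u} Δ}
    (h : B.BallIso (s + 1) C) : B.swap.BallIso s C.swap := by
  obtain ⟨φ, hφ⟩ := h
  have hB := closedBall_subset_of_adj B.adj s
  obtain ⟨ψ, hψ⟩ := exists_iso_closedBall φ hB (closedBall_subset_of_adj C.adj s)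
    ((hφ ⟨B.root₂, hB (root_mem_closedBall _ _ _)⟩).2.mp rfl)
  refine ⟨ψ, fun (x : closedBall B.graph B.root₂ s) => ?_⟩
  change ((x : B.V) = B.root₂ ↔ (ψ x : C.V) = C.root₂) ∧
    ((x : B.V) = B.root ↔ (ψ x : C.V) = C.root)
  rw [hψ x]
  exact (hφ ⟨x, hB x.2⟩).symm

theorem BiGr.ballEq_of_rho_lt {Δ : ℕ} {b c : BiGr.{u} Δ} {r : ℕ} (hr : b.rho c < (1 / 2) ^ r) :
    b.BallEq r c := by
  classical
  obtain ⟨s, hrs, B, C, hB, hC, h⟩ := exists_pow_lt_of_dist_lt (E := BiGr.BallEq)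
    (BiGr.ballEq_zero b c) (fun s => BiGr.ballEq_refl s b)
    (by convert hr using 1; simp only [BiGr.rho])
  exact ⟨B, C, hB, hC, h.of_le hrs.le⟩

theorem BiGr.rho_le_of_ballEq {Δ : ℕ} {b c : BiGr.{u} Δ} {r : ℕ} (hr : b.BallEq r c) :
    b.rho c ≤ (1 / 2) ^ r := by
  classical
  exact dist_le_pow (E := BiGr.BallEq) hr

theorem BiGr.exists_ball_subset {Δ : ℕ} {U : Set (BiGr.{u} Δ)} (hU : IsOpen U) {b : BiGr.{u} Δ}
    (hb : b ∈ U) : ∃ n : ℕ, ∀ c : BiGr.{u} Δ, b.BallEq n c → c ∈ U := by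
  obtain ⟨ε, hε, h⟩ := hU b hb
  obtain ⟨n, hn⟩ := exists_half_pow_lt hε
  exact ⟨n, fun k hk => h k ((BiGr.rho_le_of_ballEq hk).trans_lt hn)⟩

theorem BiGr.continuous_swap (Δ : ℕ) : Continuous (BiGr.swap : BiGr.{u} Δ → BiGr.{u} Δ) := by
  refine continuous_def.mpr fun U hU b hb => ?_
  obtain ⟨n, hn⟩ := BiGr.exists_ball_subset hU hb
  refine ⟨(1 / 2) ^ (n + 1), by positivity, fun c hc => ?_⟩
  obtain ⟨B, C, rfl, rfl, h⟩ := BiGr.ballEq_of_rho_lt hc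
  exact hn _ ⟨B.swap, C.swap, rfl, rfl, h.swap⟩

/-! ### Measurability of maps that are locally determined by discrete data -/

/-- Whether `f p` lies in an open set is settled by agreement with `f p` at some finite level `n`,
hence by the discrete type `τ n p`. All sets of types are measurable because each `T n` is countable
with measurable points. -/
theorem measurable_of_discrete_types {Y Z : Type*} [MeasurableSpace Y] [TopologicalSpace Z]
    [MeasurableSpace Z] [BorelSpace Z] (f : Y → Z) (E : ℕ → Z → Z → Prop)
    (hE : ∀ U : Set Z, IsOpen U → ∀ z ∈ U, ∃ n, ∀ z', E n z z' → z' ∈ U)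
    {T : ℕ → Type*} [∀ n, Countable (T n)] [∀ n, MeasurableSpace (T n)]
    [∀ n, MeasurableSingletonClass (T n)] (τ : ∀ n, Y → T n) (hτ : ∀ n, Measurable (τ n))
    (h : ∀ n p q, τ n p = τ n q → E n (f p) (f q)) : Measurable f := by
  refine measurable_of_isOpen fun U hU => ?_
  -- At level `n`, keep the types all of whose points are sent into `U`.
  have : f ⁻¹' U = ⋃ n, τ n ⁻¹' {t | ∀ q, t = τ n q → f q ∈ U} := by
    ext p
    simp only [Set.mem_preimage, Set.mem_iUnion, Set.mem_ofPred_eq]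
    constructor
    · intro hp
      obtain ⟨n, hn⟩ := hE U hU _ hp
      exact ⟨n, fun q hq => hn _ (h n p q hq)⟩
    · rintro ⟨n, hn⟩
      exact hn p rfl
  rw [this]
  exact MeasurableSet.iUnion fun n => hτ n (Set.to_countable _).measurableSet

namespace MeasurableGraphing

variable {X : Type u} [MeasurableSpace X] {k : ℕ}

/-! ### Words in the involutions -/

/-- The action of a word in the involutions on the points. -/
def act (𝒢 : MeasurableGraphing X k) (w : List (Fin k)) (x : X) : X := w.foldr 𝒢.i x

theorem measurable_act (𝒢 : MeasurableGraphing X k) (w : List (Fin k)) : Measurable (𝒢.act w) := by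
  induction w with
  | nil => exact measurable_id
  | cons j w ih => exact (𝒢.measurePreserving j).measurable.comp ih

theorem act_mem_closedBall (𝒢 : MeasurableGraphing X k) (x : X) {w : List (Fin k)} {n : ℕ}
    (hw : w.length ≤ n) : 𝒢.act w x ∈ closedBall 𝒢.leafgraph x n := by
  induction w generalizing n with
  | nil => exact root_mem_closedBall _ _ _
  | cons j w ih =>
    obtain ⟨m, rfl⟩ : ∃ m, n = m + 1 := ⟨n - 1, by simp at hw; omega⟩
    have hm := ih (n := m) (by simpa using hw)
    have hm' : 𝒢.leafgraph.edist x (𝒢.act w x) ≤ m := hm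
    -- The involution `i_j` may fix the point reached so far; that letter then contributes no edge.
    by_cases he : 𝒢.act w x = 𝒢.act (j :: w) x
    · exact he ▸ closedBall_mono _ _ (Nat.le_succ m) hm
    · have hadj : 𝒢.leafgraph.Adj (𝒢.act w x) (𝒢.act (j :: w) x) := ⟨he, j, rfl⟩
      calc 𝒢.leafgraph.edist x (𝒢.act (j :: w) x)
          ≤ 𝒢.leafgraph.edist x (𝒢.act w x)
            + 𝒢.leafgraph.edist (𝒢.act w x) (𝒢.act (j :: w) x) := 𝒢.leafgraph.edist_triangle
        _ ≤ m + 1 := add_le_add hm' (SimpleGraph.edist_eq_one_iff_adj.mpr hadj).le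
        _ = ((m + 1 : ℕ) : ℕ∞) := by push_cast; rfl

theorem exists_act_eq_of_walk (𝒢 : MeasurableGraphing X k) {x y : X} (p : 𝒢.leafgraph.Walk x y) :
    ∃ w : List (Fin k), w.length ≤ p.length ∧ 𝒢.act w x = y := by
  induction p with
  | nil => exact ⟨[], le_rfl, rfl⟩
  | cons h p ih =>
    obtain ⟨_, j, rfl⟩ := h
    obtain ⟨w, hw, hy⟩ := ih
    -- The last letter of a word acts first, so the first edge of the walk becomes the last letter.
    exact ⟨w ++ [j], by rw [List.length_append]; exact Nat.succ_le_succ hw, by rw [← hy]; simp [act]⟩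

theorem exists_act_eq (𝒢 : MeasurableGraphing X k) {x y : X} {n : ℕ}
    (hy : y ∈ closedBall 𝒢.leafgraph x n) :
    ∃ w : List (Fin k), w.length ≤ n ∧ 𝒢.act w x = y := by
  obtain ⟨p, hp⟩ := exists_walk_of_mem_closedBall hy
  obtain ⟨w, hw, h⟩ := 𝒢.exists_act_eq_of_walk p
  exact ⟨w, hw.trans hp, h⟩

/-- The coincidences between the images of a point under the words of length at most `n + 1`. -/
def wordType (𝒢 : MeasurableGraphing X k) (n : ℕ) (x : X) :
    {w : List (Fin k) // w.length ≤ n + 1} → {w : List (Fin k) // w.length ≤ n + 1} → Prop :=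
  fun v w => 𝒢.act v x = 𝒢.act w x

/-- Makes the space of word types countable, as `measurable_of_discrete_types` requires. -/
instance finite_words (k n : ℕ) : Finite {w : List (Fin k) // w.length ≤ n} :=
  (List.finite_length_le (Fin k) n).to_subtype

theorem measurable_wordType [StandardBorelSpace X] (𝒢 : MeasurableGraphing X k) (n : ℕ) :
    Measurable (𝒢.wordType n) :=
  measurable_pi_iff.mpr fun v => measurable_pi_iff.mpr fun w =>
    measurableSet_setOfPred.mp (measurableSet_eq_fun (𝒢.measurable_act v) (𝒢.measurable_act w))

theorem act_eq_act_iff (𝒢 : MeasurableGraphing X k) {n : ℕ} {x x' : X}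
    (h : 𝒢.wordType n x = 𝒢.wordType n x') {v w : List (Fin k)} (hv : v.length ≤ n + 1)
    (hw : w.length ≤ n + 1) : 𝒢.act v x = 𝒢.act w x ↔ 𝒢.act v x' = 𝒢.act w x' :=
  iff_of_eq (congrFun (congrFun h ⟨v, hv⟩) ⟨w, hw⟩)

/-- Send the image of `x` under a word to the image of `x'` under the same word; equal coincidences
make this independent of the word and bijective. Adjacency of two points of the ball asks whether
some `i_j` carries one to the other, which compares a word of length at most `n` with one of length
at most `n + 1`; this is the reason for the extra letter in `wordType`. The final clause locates the
roots. -/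
theorem exists_iso_of_wordType_eq (𝒢 : MeasurableGraphing X k) {n : ℕ} {x x' : X}
    (h : 𝒢.wordType n x = 𝒢.wordType n x') :
    ∃ φ : 𝒢.leafgraph.induce (closedBall 𝒢.leafgraph x n) ≃g
        𝒢.leafgraph.induce (closedBall 𝒢.leafgraph x' n),
      ∀ (y : closedBall 𝒢.leafgraph x n) (w : List (Fin k)), w.length ≤ n + 1 →
        ((y : X) = 𝒢.act w x ↔ (φ y : X) = 𝒢.act w x') := by
  have hex : ∀ (x : X) (y : closedBall 𝒢.leafgraph x n),
      ∃ w : List (Fin k), w.length ≤ n ∧ 𝒢.act w x = y := fun x y => 𝒢.exists_act_eq y.2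
  choose W hW hact using hex
  let f : ∀ x x' : X, closedBall 𝒢.leafgraph x n → closedBall 𝒢.leafgraph x' n := fun x x' y =>
    ⟨𝒢.act (W x y) x', 𝒢.act_mem_closedBall x' (hW x y)⟩
  have hf : ∀ {x x' : X}, 𝒢.wordType n x = 𝒢.wordType n x' →
      ∀ (y : closedBall 𝒢.leafgraph x n) (w : List (Fin k)), w.length ≤ n + 1 →
        ((y : X) = 𝒢.act w x ↔ (f x x' y : X) = 𝒢.act w x') := by
    intro x x' h y w hw
    rw [← hact x y]
    exact 𝒢.act_eq_act_iff h ((hW x y).trans (Nat.le_succ n)) hw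
  have hinv : ∀ {x x' : X}, 𝒢.wordType n x = 𝒢.wordType n x' →
      ∀ y : closedBall 𝒢.leafgraph x n, f x' x (f x x' y) = y := by
    intro x x' h y
    have hw := (hW x y).trans (Nat.le_succ n)
    apply Subtype.ext
    -- The word chosen for `f x x' y` from `x'` may differ from `W x y`, but by `hf` any word
    -- representing that point gives the same image.
    rw [(hf h.symm (f x x' y) (W x y) hw).mp rfl, hact]
  refine ⟨⟨⟨f x x', f x' x, hinv h, hinv h.symm⟩, ?_⟩, hf h⟩
  intro y z
  change 𝒢.leafgraph.Adj (f x x' y) (f x x' z) ↔ 𝒢.leafgraph.Adj y z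
  have hinj : (f x x' y : X) = f x x' z ↔ (y : X) = z := by
    rw [← Subtype.ext_iff, ← Subtype.ext_iff]
    exact (Function.LeftInverse.injective (hinv h)).eq_iff
  have hz : ∀ j, (f x x' z : X) = 𝒢.i j (f x x' y) ↔ (z : X) = 𝒢.i j y := by
    intro j
    have := hf h z (j :: W x y) (by simpa using hW x y)
    rw [show 𝒢.act (j :: W x y) x = 𝒢.i j y from congrArg (𝒢.i j) (hact x y)] at this
    exact this.symm
  simp only [leafgraph, ne_eq, hinj, hz]

/-! ### Components of the leafgraph -/

variable {Δ : ℕ}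

/-- The vertex set of the component of `x`. -/
def component (𝒢 : MeasurableGraphing X k) (x : X) : Set X := {y | 𝒢.leafgraph.Reachable x y}

theorem self_mem_component (𝒢 : MeasurableGraphing X k) (x : X) : x ∈ 𝒢.component x :=
  SimpleGraph.Reachable.refl x

theorem closedBall_subset_component (𝒢 : MeasurableGraphing X k) (x : X) (n : ℕ) :
    closedBall 𝒢.leafgraph x n ⊆ 𝒢.component x := fun _ hy =>
  let ⟨p, _⟩ := exists_walk_of_mem_closedBall hy
  ⟨p⟩

theorem component_countable (𝒢 : MeasurableGraphing X k) (x : X) : (𝒢.component x).Countable := by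
  refine (Set.countable_range fun w : List (Fin k) => 𝒢.act w x).mono ?_
  rintro y ⟨p⟩
  obtain ⟨w, _, hw⟩ := 𝒢.exists_act_eq_of_walk p
  exact ⟨w, hw⟩

theorem component_connected (𝒢 : MeasurableGraphing X k) (x : X) :
    (𝒢.leafgraph.induce (𝒢.component x)).Connected := by
  rw [SimpleGraph.connected_iff_exists_forall_reachable]
  refine ⟨⟨x, 𝒢.self_mem_component x⟩, ?_⟩
  rintro ⟨y, ⟨p⟩⟩
  classical
  have hs : ∀ z ∈ p.support, z ∈ 𝒢.component x := fun z hz => ⟨p.takeUntil z hz⟩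
  exact ⟨p.induce _ hs⟩

/-- The component of `x` in the leafgraph, rooted at `x`. -/
def rootedComponent (𝒢 : MeasurableGraphing X k)
    (hΔ : ∀ x, (𝒢.leafgraph.neighborSet x).encard ≤ Δ) (x : X) : RootedGraph.{u} Δ where
  V := 𝒢.component x
  graph := 𝒢.leafgraph.induce (𝒢.component x)
  countable := (𝒢.component_countable x).to_subtype
  connected := 𝒢.component_connected x
  degree_le y := by
    refine le_trans ?_ (hΔ y)
    rw [← Subtype.val_injective.encard_image]
    apply Set.encard_le_encard
    rintro _ ⟨z, hz, rfl⟩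
    exact hz
  root := ⟨x, 𝒢.self_mem_component x⟩

/-- The component of `x` in the leafgraph, rooted at `x` and its neighbour `y`. -/
def birootedComponent (𝒢 : MeasurableGraphing X k)
    (hΔ : ∀ x, (𝒢.leafgraph.neighborSet x).encard ≤ Δ) (p : 𝒢.edgeSet) : BirootedGraph.{u} Δ :=
  (𝒢.rootedComponent hΔ p.1.1).birooted
    ⟨p.1.2, SimpleGraph.Adj.reachable (show 𝒢.leafgraph.Adj p.1.1 p.1.2 from p.2)⟩ p.2

/-- The restriction of the component of `x` to a ball around `x` is a ball of the leafgraph. -/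
def componentBallIso (𝒢 : MeasurableGraphing X k) (x : X) (n : ℕ) :
    (𝒢.leafgraph.induce (𝒢.component x)).induce (closedBall (𝒢.leafgraph.induce (𝒢.component x))
      ⟨x, 𝒢.self_mem_component x⟩ n) ≃g 𝒢.leafgraph.induce (closedBall 𝒢.leafgraph x n) :=
  induceBallIso ⟨x, 𝒢.self_mem_component x⟩ n (𝒢.closedBall_subset_component x n)

/-- Points of `Gr` are connected graphs while the leafgraph need not be; passing to the component
changes no ball. -/
theorem ball_rootedComponent (𝒢 : MeasurableGraphing X k)
    (hΔ : ∀ x, (𝒢.leafgraph.neighborSet x).encard ≤ Δ) (x : X) (r : ℕ) :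
    (𝒢.rootedComponent hΔ x).cls.ball r = ballClass 𝒢.leafgraph hΔ x r :=
  Quotient.sound ⟨𝒢.componentBallIso x r, rfl⟩

theorem ballClass_eq_of_wordType_eq (𝒢 : MeasurableGraphing X k)
    (hΔ : ∀ x, (𝒢.leafgraph.neighborSet x).encard ≤ Δ) {n : ℕ} {x x' : X}
    (h : 𝒢.wordType n x = 𝒢.wordType n x') :
    ballClass 𝒢.leafgraph hΔ x n = ballClass 𝒢.leafgraph hΔ x' n := by
  obtain ⟨φ, hφ⟩ := 𝒢.exists_iso_of_wordType_eq h
  -- The root is the image of itself under the empty word.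
  exact Quotient.sound ⟨φ, Subtype.ext
    ((hφ ⟨x, root_mem_closedBall _ _ _⟩ [] (Nat.zero_le _)).mp rfl)⟩

theorem measurable_rootedComponent [StandardBorelSpace X] (𝒢 : MeasurableGraphing X k)
    (hΔ : ∀ x, (𝒢.leafgraph.neighborSet x).encard ≤ Δ) :
    Measurable fun x => (𝒢.rootedComponent hΔ x).cls :=
  measurable_of_discrete_types _ (fun n g h => g.ball n = h.ball n)
    (fun _ hU _ hg => Gr.exists_ball_subset hU hg) 𝒢.wordType 𝒢.measurable_wordType
    fun n x x' h => by
      rw [ball_rootedComponent, ball_rootedComponent]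
      exact 𝒢.ballClass_eq_of_wordType_eq hΔ h

/-- The type of the first end point of an edge, together with the involutions that carry it to the
second end point. -/
def edgeType (𝒢 : MeasurableGraphing X k) (n : ℕ) (p : 𝒢.edgeSet) :
    ({w : List (Fin k) // w.length ≤ n + 1} → {w : List (Fin k) // w.length ≤ n + 1} → Prop) ×
      (Fin k → Prop) :=
  (𝒢.wordType n p.1.1, fun j => p.1.2 = 𝒢.i j p.1.1)

theorem measurable_edgeType [StandardBorelSpace X] (𝒢 : MeasurableGraphing X k) (n : ℕ) :
    Measurable (𝒢.edgeType n) := by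
  have h1 : Measurable fun p : 𝒢.edgeSet => p.1.1 := measurable_fst.comp measurable_subtype_coe
  have h2 : Measurable fun p : 𝒢.edgeSet => p.1.2 := measurable_snd.comp measurable_subtype_coe
  exact ((𝒢.measurable_wordType n).comp h1).prodMk (measurable_pi_iff.mpr fun j =>
    measurableSet_setOfPred.mp
      (measurableSet_eq_fun h2 ((𝒢.measurePreserving j).measurable.comp h1)))

theorem ballIso_of_edgeType_eq (𝒢 : MeasurableGraphing X k)
    (hΔ : ∀ x, (𝒢.leafgraph.neighborSet x).encard ≤ Δ) {n : ℕ} {p q : 𝒢.edgeSet}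
    (h : 𝒢.edgeType n p = 𝒢.edgeType n q) :
    (𝒢.birootedComponent hΔ p).BallIso n (𝒢.birootedComponent hΔ q) := by
  obtain ⟨φ, hφ⟩ := 𝒢.exists_iso_of_wordType_eq (congrArg Prod.fst h)
  obtain ⟨j, hj⟩ : ∃ j, p.1.2 = 𝒢.i j p.1.1 := p.2.2
  have hj' : q.1.2 = 𝒢.i j q.1.1 := (congrFun (congrArg Prod.snd h) j).mp hj
  let ψ := ((𝒢.componentBallIso p.1.1 n).trans φ).trans (𝒢.componentBallIso q.1.1 n).symm
  refine ⟨ψ, fun z => ?_⟩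
  have h1 := hφ (𝒢.componentBallIso p.1.1 n z) [] (Nat.zero_le _)
  -- The second root is the image of the first under the one-letter word `[j]`, with the same `j`
  -- for both edges. Its length is within `n + 1` even for `n = 0`, when the second root is outside
  -- the ball.
  have h2 := hφ (𝒢.componentBallIso p.1.1 n z) [j] (by simp)
  rw [show 𝒢.act [j] p.1.1 = p.1.2 from hj.symm, show 𝒢.act [j] q.1.1 = q.1.2 from hj'.symm] at h2
  have e : ∀ (x : X) (a b : 𝒢.component x), a = b ↔ (a : X) = b := fun _ _ _ => Subtype.ext_iff
  exact ⟨(e p.1.1 z.1 (𝒢.birootedComponent hΔ p).root).trans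
      (h1.trans (e q.1.1 (ψ z).1 (𝒢.birootedComponent hΔ q).root).symm),
    (e p.1.1 z.1 (𝒢.birootedComponent hΔ p).root₂).trans
      (h2.trans (e q.1.1 (ψ z).1 (𝒢.birootedComponent hΔ q).root₂).symm)⟩

theorem measurable_birootedComponent [StandardBorelSpace X] (𝒢 : MeasurableGraphing X k)
    (hΔ : ∀ x, (𝒢.leafgraph.neighborSet x).encard ≤ Δ) :
    Measurable fun p => (𝒢.birootedComponent hΔ p).cls :=
  measurable_of_discrete_types _ BiGr.BallEq (fun _ hU _ hb => BiGr.exists_ball_subset hU hb)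
    𝒢.edgeType 𝒢.measurable_edgeType
    fun _ _ _ h => ⟨_, _, rfl, rfl, 𝒢.ballIso_of_edgeType_eq hΔ h⟩

theorem swap_birootedComponent (𝒢 : MeasurableGraphing X k)
    (hΔ : ∀ x, (𝒢.leafgraph.neighborSet x).encard ≤ Δ) (p : 𝒢.edgeSet) :
    (𝒢.birootedComponent hΔ p).cls.swap = (𝒢.birootedComponent hΔ (𝒢.edgeSwap p)).cls := by
  have hr : 𝒢.leafgraph.Reachable p.1.1 p.1.2 :=
    SimpleGraph.Adj.reachable (show 𝒢.leafgraph.Adj p.1.1 p.1.2 from p.2)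
  have hS : 𝒢.component p.1.1 = 𝒢.component p.1.2 :=
    Set.ext fun z => ⟨hr.symm.trans, hr.trans⟩
  let φ : 𝒢.leafgraph.induce (𝒢.component p.1.1) ≃g 𝒢.leafgraph.induce (𝒢.component p.1.2) :=
    ⟨Equiv.setCongr hS, Iff.rfl⟩
  exact Quotient.sound ⟨φ, rfl, rfl⟩

/-! ### The law of a graphing -/

theorem isLaw_map [StandardBorelSpace X] (𝒢 : MeasurableGraphing X k)
    (hΔ : ∀ x, (𝒢.leafgraph.neighborSet x).encard ≤ Δ) :
    𝒢.IsLaw hΔ (𝒢.μ.map fun x => (𝒢.rootedComponent hΔ x).cls) := by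
  have := 𝒢.isProbabilityMeasure
  have hm := 𝒢.measurable_rootedComponent hΔ
  refine ⟨Measure.isProbabilityMeasure_map hm.aemeasurable, fun r α _ => ?_⟩
  rw [Measure.map_apply hm (measurableSet_cylinder r α)]
  congr 1
  ext x
  change (𝒢.rootedComponent hΔ x).cls.ball r = α ↔ _
  rw [ball_rootedComponent]
  rfl

/-- The law is prescribed only at classes in `rootedBalls`, but every nonempty cylinder is of that
kind, since `g.ball r` is itself a rooted `r`-ball. -/
theorem IsLaw.unique {𝒢 : MeasurableGraphing X k}
    {hΔ : ∀ x, (𝒢.leafgraph.neighborSet x).encard ≤ Δ} {Ψ Ψ' : Measure (Gr.{u} Δ)}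
    (h : 𝒢.IsLaw hΔ Ψ) (h' : 𝒢.IsLaw hΔ Ψ') : Ψ = Ψ' := by
  have := h.1
  have := h'.1
  refine ext_of_generate_finite _ (borel_eq_generateFrom_cylinders Δ) (isPiSystem_cylinders Δ) ?_
    (by simp)
  rintro _ ⟨r, g, rfl⟩
  rw [h.2 r _ (g.ball_mem_rootedBalls r), h'.2 r _ (g.ball_mem_rootedBalls r)]

/-! ### Involution invariance -/

theorem edgeCount_rootedComponent (𝒢 : MeasurableGraphing X k)
    (hΔ : ∀ x, (𝒢.leafgraph.neighborSet x).encard ≤ Δ) (A : Set (BiGr.{u} Δ)) (x : X) :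
    edgeCount A (𝒢.rootedComponent hΔ x).cls =
      (𝒢.edgesIn ((fun p => (𝒢.birootedComponent hΔ p).cls) ⁻¹' A) x).encard := by
  change ((𝒢.rootedComponent hΔ x).edgesIn A).encard = _
  refine ((Subtype.val_injective (p := (· ∈ 𝒢.component x))).encard_image _).symm.trans ?_
  congr 1
  ext y
  constructor
  · rintro ⟨z, ⟨h, hA⟩, rfl⟩
    exact ⟨h, hA⟩
  · rintro ⟨h, hA⟩
    exact ⟨⟨y, h.reachable⟩, ⟨h, hA⟩, rfl⟩

/-- A change of variables: the neighbours of `x` in its component are its neighbours in the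
leafgraph, so the two counting functions correspond pointwise. -/
theorem edgeMeasure_map_rootedComponent [StandardBorelSpace X] (𝒢 : MeasurableGraphing X k)
    (hΔ : ∀ x, (𝒢.leafgraph.neighborSet x).encard ≤ Δ) :
    Graphings.edgeMeasure (𝒢.μ.map fun x => (𝒢.rootedComponent hΔ x).cls) =
      𝒢.edgeMeasure.map fun p => (𝒢.birootedComponent hΔ p).cls := by
  have hm := 𝒢.measurable_birootedComponent hΔ
  ext A hA
  rw [Graphings.edgeMeasure_apply _ hA, lintegral_map (measurable_edgeCount A hA)
    (𝒢.measurable_rootedComponent hΔ), Measure.map_apply hm hA, edgeMeasure_apply 𝒢 (hm hA)]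
  simp only [edgeCount_rootedComponent]

theorem measurable_edgeSwap (𝒢 : MeasurableGraphing X k) : Measurable 𝒢.edgeSwap :=
  Measurable.subtype_mk (measurable_swap.comp measurable_subtype_coe)

theorem IsInvolutionInvariant.map_rootedComponent [StandardBorelSpace X]
    {𝒢 : MeasurableGraphing X k} (h : 𝒢.IsInvolutionInvariant)
    (hΔ : ∀ x, (𝒢.leafgraph.neighborSet x).encard ≤ Δ) :
    Graphings.IsInvolutionInvariant (𝒢.μ.map fun x => (𝒢.rootedComponent hΔ x).cls) := by
  have hm := 𝒢.measurable_birootedComponent hΔ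
  rw [Graphings.IsInvolutionInvariant, edgeMeasure_map_rootedComponent,
    Measure.map_map (BiGr.continuous_swap Δ).measurable hm]
  -- With the hypothesis inserted on the right only, both sides are push-forwards of the same
  -- measure, and the two maps agree because the swaps are intertwined.
  conv_rhs => rw [← show 𝒢.edgeMeasure.map 𝒢.edgeSwap = 𝒢.edgeMeasure from h,
    Measure.map_map hm 𝒢.measurable_edgeSwap]
  congr 1
  exact funext fun p => 𝒢.swap_birootedComponent hΔ p

/-- The points `x` such that `(x, i_j x)` is an edge in `B` and `j` is least with this end point. -/
def leastEdgesIn (𝒢 : MeasurableGraphing X k) (B : Set 𝒢.edgeSet) (j : Fin k) : Set X :=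
  {x | (∀ l, l < j → 𝒢.i l x ≠ 𝒢.i j x) ∧ 𝒢.i j x ∈ 𝒢.edgesIn B x}

/-- Several involutions may carry `x` to the same neighbour; choosing the least index counts each
neighbour exactly once. -/
theorem encard_edgesIn (𝒢 : MeasurableGraphing X k) (B : Set 𝒢.edgeSet) (x : X) :
    ((𝒢.edgesIn B x).encard : ℝ≥0∞) = ∑ j, (𝒢.leastEdgesIn B j).indicator 1 x := by
  classical
  have hU : 𝒢.edgesIn B x = ⋃ j, {y | y = 𝒢.i j x ∧ x ∈ 𝒢.leastEdgesIn B j} := by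
    ext y
    simp only [Set.mem_iUnion, Set.mem_ofPred_eq]
    constructor
    · intro hy
      obtain ⟨⟨hne, hj⟩, hmem⟩ := id hy
      obtain ⟨j, hj, hmin⟩ := WellFounded.has_min (wellFounded_lt (α := Fin k))
        {j | y = 𝒢.i j x} hj
      have hj : y = 𝒢.i j x := hj
      exact ⟨j, hj, fun l hl he => hmin l (hj.trans he.symm) hl, hj ▸ hy⟩
    · rintro ⟨j, rfl, _, h⟩
      exact h
  rw [hU, encard_iUnion_eq_tsum, tsum_fintype]
  · refine Finset.sum_congr rfl fun j _ => ?_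
    by_cases hx : x ∈ 𝒢.leastEdgesIn B j <;> simp [hx]
  · intro j l hjl
    refine Set.disjoint_left.mpr ?_
    rintro y ⟨hy, hj⟩ ⟨hy', hl⟩
    rcases lt_or_gt_of_ne hjl with h | h
    · exact hl.1 j h (hy.symm.trans hy')
    · exact hj.1 l h (hy'.symm.trans hy)

theorem measurableSet_leastEdgesIn [StandardBorelSpace X] (𝒢 : MeasurableGraphing X k)
    {B : Set 𝒢.edgeSet} (hB : MeasurableSet B) (j : Fin k) :
    MeasurableSet (𝒢.leastEdgesIn B j) := by
  obtain ⟨B', hB', rfl⟩ := hB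
  have hi : ∀ j, Measurable (𝒢.i j) := fun j => (𝒢.measurePreserving j).measurable
  have : 𝒢.leastEdgesIn (Subtype.val ⁻¹' B') j =
      (⋂ (l) (_ : l < j), {x | 𝒢.i l x = 𝒢.i j x}ᶜ) ∩
        ({x | x = 𝒢.i j x}ᶜ ∩ (fun x => (x, 𝒢.i j x)) ⁻¹' B') := by
    ext x
    simp only [leastEdgesIn, Set.mem_inter_iff, Set.mem_iInter, Set.mem_compl_iff,
      Set.mem_ofPred_eq]
    exact and_congr Iff.rfl ⟨fun ⟨h, hm⟩ => ⟨h.1, hm⟩, fun ⟨h, hm⟩ => ⟨⟨h, j, rfl⟩, hm⟩⟩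
  rw [this]
  exact (MeasurableSet.iInter fun l => MeasurableSet.iInter fun _ =>
    (measurableSet_eq_fun (hi l) (hi j)).compl).inter
    ((measurableSet_eq_fun measurable_id (hi j)).compl.inter
      ((measurable_id.prodMk (hi j)) hB'))

theorem edgeMeasure_eq_sum [StandardBorelSpace X] (𝒢 : MeasurableGraphing X k)
    {B : Set 𝒢.edgeSet} (hB : MeasurableSet B) :
    𝒢.edgeMeasure B = ∑ j, 𝒢.μ (𝒢.leastEdgesIn B j) := by
  rw [edgeMeasure_apply 𝒢 hB]
  simp only [encard_edgesIn]
  rw [lintegral_finsetSum _ fun j _ =>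
    measurable_one.indicator (𝒢.measurableSet_leastEdgesIn hB j)]
  exact Finset.sum_congr rfl fun j _ => lintegral_indicator_one (𝒢.measurableSet_leastEdgesIn hB j)

/-- Being the least index is symmetric in the two end points: for `y = i_j x`, one has `i_l x = y`
exactly when `i_l y = x`. -/
theorem leastEdgesIn_preimage_edgeSwap (𝒢 : MeasurableGraphing X k) (B : Set 𝒢.edgeSet)
    (j : Fin k) :
    𝒢.leastEdgesIn (𝒢.edgeSwap ⁻¹' B) j = 𝒢.i j ⁻¹' 𝒢.leastEdgesIn B j := by
  ext x
  have hinv := 𝒢.involutive j x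
  refine and_congr (forall₂_congr fun l _ => not_congr ?_) ?_
  · rw [hinv, (𝒢.involutive l).eq_iff, eq_comm]
  · rw [hinv]
    exact ⟨fun ⟨h, hB⟩ => ⟨h.symm, hB⟩, fun ⟨h, hB⟩ => ⟨h.symm, hB⟩⟩

/-- Measure preserving involutions make the measure of a graphing involution invariant. -/
theorem isInvolutionInvariant [StandardBorelSpace X] (𝒢 : MeasurableGraphing X k) :
    𝒢.IsInvolutionInvariant := by
  refine Measure.ext fun B hB => ?_
  rw [Measure.map_apply 𝒢.measurable_edgeSwap hB,
    edgeMeasure_eq_sum 𝒢 (𝒢.measurable_edgeSwap hB), edgeMeasure_eq_sum 𝒢 hB]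
  refine Finset.sum_congr rfl fun j _ => ?_
  rw [leastEdgesIn_preimage_edgeSwap]
  exact (𝒢.measurePreserving j).measure_preimage
    (𝒢.measurableSet_leastEdgesIn hB j).nullMeasurableSet

end MeasurableGraphing

end Graphings

theorem mainTheorem5 {X : Type u} [MeasurableSpace X] [StandardBorelSpace X] {k Δ : ℕ}
    (𝒢 : Graphings.MeasurableGraphing X k)
    (hΔ : ∀ x, (𝒢.leafgraph.neighborSet x).encard ≤ Δ) :
    (∃! Ψ : Measure (Graphings.Gr.{u} Δ), 𝒢.IsLaw hΔ Ψ) ∧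
      ∀ Ψ : Measure (Graphings.Gr.{u} Δ), 𝒢.IsLaw hΔ Ψ →
        (Graphings.IsInvolutionInvariant Ψ ↔ 𝒢.IsInvolutionInvariant) := by
  have hlaw := 𝒢.isLaw_map hΔ
  refine ⟨⟨_, hlaw, fun Ψ hΨ => hΨ.unique hlaw⟩, fun Ψ hΨ => ?_⟩
  rw [hΨ.unique hlaw]
  -- The forward implication draws nothing from the law: its conclusion holds for every graphing.
  exact ⟨fun _ => 𝒢.isInvolutionInvariant, fun h => h.map_rootedComponent hΔ⟩
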